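/- Let $\mathbb D$ be the open unit disc of $\mathbb C$. For a weight $v:\mathbb D\to(0,\infty)$ (bounded and continuous), let $H_v^\infty$ be the Banach space of holomorphic $f:\mathbb D\to\mathbb C$ with $\|f\|_{H_v^\infty}=\sup_{z\in\mathbb D}v(z)|f(z)|<\infty$, and let $\mathcal B^v$ be the Banach space of holomorphic $f:\mathbb D\to\mathbb C$ with $\|f\|_{\mathcal B^v}=|f(0)|+\|f'\|_{H_v^\infty}<\infty$. Consider the weights $$v_{\log}(z)=(1-|z|)\log\frac{2}{1-|z|},\qquad w_{\log}(z)=\Bigl[\log\log\frac{4}{1-|z|^2}\Bigr]^{-1}.$$ For holomorphic $u:\mathbb D\to\mathbb C$ and $\varphi:\mathbb D\to\mathbb D$ put $W_{u,\varphi}f=u\cdot(f\circ\varphi)$ and $J_u f(z)=\int_0^z f(s)u'(s)\,ds$, let $\varphi^n$ denote the function $z\mapsto\varphi(z)^n$, and let $g_n(z)=z^n$. The essential norm $\|T\|_e^{X\to Y}$ of a bounded linear operator $T:X\to Y$ between Banach spaces is the infimum of $\|T-K\|^{X\to Y}$ over all compact linear operators $K:X\to Y$. There is an absolute constant $C>0$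 such that for all holomorphic $u:\mathbb D\to\mathbb C$ and $\varphi:\mathbb D\to\mathbb D$ the following hold (the right-hand sides being understood in $[0,\infty]$). 1. If $W_{u,\varphi}$ maps $\mathcal B^{v_{\log}}$ boundedly into $H^\infty_{v_{\log}}$, then $$\|W_{u,\varphi}\|_e^{\mathcal B^{v_{\log}}\to H^\infty_{v_{\log}}}\le C\,\limsup_{n\to\infty}\frac{\|u\varphi^n\|_{H^\infty_{v_{\log}}}}{\|g_n\|_{H^\infty_{w_{\log}}}}.$$ 2. If $W_{u',\varphi}$ maps $\mathcal B^{v_{\log}}$ boundedly into $H^\infty_{v_{\log}}$, then $$\|W_{u',\varphi}\|_e^{\mathcal B^{v_{\log}}\to H^\infty_{v_{\log}}}\le C\,\limsup_{n\to\infty}\frac{(n+1)\,\|J_u(\varphi^n)\|_{\mathcal B^{v_{\log}}}}{\|g_{n+1}\|_{\mathcal B^{w_{\log}}}}.$$ -/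

import Mathlib

open Complex.UnitDisc Filter
open scoped ENNReal

noncomputable section

namespace LogBloch

/-- The extension by `0` to the complex plane of a function on the open unit disc. -/
def ext (f : 𝔻 → ℂ) (z : ℂ) : ℂ :=
  if h : ‖z‖ < 1 then f (Complex.UnitDisc.mk z h) else 0

/-- `f` is holomorphic on the open unit disc. -/
def IsHolo (f : 𝔻 → ℂ) : Prop :=
  DifferentiableOn ℂ (ext f) (Metric.ball 0 1)

/-- The derivative `f'` of a (holomorphic) function on the disc. -/
def derivD (f : 𝔻 → ℂ) (z : 𝔻) : ℂ :=
  deriv (ext f) (z : ℂ)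

theorem ext_coe (f : 𝔻 → ℂ) (z : 𝔻) : ext f (z : ℂ) = f z := by
  have h : ‖(z : ℂ)‖ < 1 := z.norm_lt_one
  simp [ext, h]

theorem ext_add (f g : 𝔻 → ℂ) : ext (f + g) = ext f + ext g := by
  funext z
  by_cases h : ‖z‖ < 1 <;> simp [ext, h]

theorem ext_smul (c : ℂ) (f : 𝔻 → ℂ) : ext (c • f) = c • ext f := by
  funext z
  by_cases h : ‖z‖ < 1 <;> simp [ext, h]

theorem ext_zero : ext (0 : 𝔻 → ℂ) = 0 := by
  funext z
  simp [ext]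

theorem isHolo_zero : IsHolo 0 := by
  rw [IsHolo, ext_zero]
  exact differentiableOn_const 0

theorem IsHolo.add {f g : 𝔻 → ℂ} (hf : IsHolo f) (hg : IsHolo g) : IsHolo (f + g) := by
  rw [IsHolo, ext_add]
  exact DifferentiableOn.add hf hg

theorem IsHolo.smul {f : 𝔻 → ℂ} (c : ℂ) (hf : IsHolo f) : IsHolo (c • f) := by
  rw [IsHolo, ext_smul]
  exact DifferentiableOn.const_smul hf c

theorem IsHolo.differentiableAt {f : 𝔻 → ℂ} (hf : IsHolo f) (z : 𝔻) :
    DifferentiableAt ℂ (ext f) (z : ℂ) :=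
  DifferentiableOn.differentiableAt hf
    (Metric.isOpen_ball.mem_nhds (by simpa using z.norm_lt_one))

theorem derivD_zero : derivD 0 = 0 := by
  funext z
  simp [derivD, ext_zero]

theorem derivD_add {f g : 𝔻 → ℂ} (hf : IsHolo f) (hg : IsHolo g) :
    derivD (f + g) = derivD f + derivD g := by
  funext z
  simp only [derivD, ext_add, Pi.add_apply]
  exact deriv_add (hf.differentiableAt z) (hg.differentiableAt z)

theorem derivD_smul {f : 𝔻 → ℂ} (c : ℂ) (hf : IsHolo f) :
    derivD (c • f) = c • derivD f := by
  funext z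
  simp only [derivD, ext_smul, Pi.smul_apply]
  exact deriv_const_smul c (hf.differentiableAt z)

theorem IsHolo.eq_zero {f : 𝔻 → ℂ} (hf : IsHolo f) (h0 : f 0 = 0) (hd : derivD f = 0) :
    f = 0 := by
  funext z
  have key := Metric.isOpen_ball.is_const_of_deriv_eq_zero
    (convex_ball (0 : ℂ) 1).isPreconnected hf
    (fun x hx => by
      have hx' : ‖x‖ < 1 := by simpa using hx
      exact congrFun hd (Complex.UnitDisc.mk x hx'))
    (show (z : ℂ) ∈ Metric.ball (0 : ℂ) 1 by simpa using z.norm_lt_one)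
    (show ((0 : 𝔻) : ℂ) ∈ Metric.ball (0 : ℂ) 1 by simp)
  rw [ext_coe, ext_coe, h0] at key
  exact key

/-- A weight on the unit disc: a bounded, continuous and positive function. -/
structure Weight where
  toFun : 𝔻 → ℝ
  continuous_toFun : Continuous toFun
  pos : ∀ z, 0 < toFun z
  bounded : ∃ M, ∀ z, toFun z ≤ M

/-- `‖f‖_{H_v^∞} = sup_z v(z) |f(z)|`, as an element of `[0, ∞]`. -/
def hNorm (v : Weight) (f : 𝔻 → ℂ) : ℝ≥0∞ :=
  ⨆ z : 𝔻, ENNReal.ofReal (v.toFun z) * ‖f z‖ₑ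

/-- `‖f‖_{B^v} = |f(0)| + sup_z v(z) |f'(z)|`, as an element of `[0, ∞]`. -/
def bNorm (v : Weight) (f : 𝔻 → ℂ) : ℝ≥0∞ :=
  ‖f 0‖ₑ + hNorm v (derivD f)

theorem hNorm_zero (v : Weight) : hNorm v 0 = 0 := by
  simp [hNorm]

theorem hNorm_add_le (v : Weight) (f g : 𝔻 → ℂ) :
    hNorm v (f + g) ≤ hNorm v f + hNorm v g := by
  refine iSup_le fun z => ?_
  calc ENNReal.ofReal (v.toFun z) * ‖(f + g) z‖ₑ
      ≤ ENNReal.ofReal (v.toFun z) * (‖f z‖ₑ + ‖g z‖ₑ) := by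
        gcongr
        exact enorm_add_le _ _
    _ = ENNReal.ofReal (v.toFun z) * ‖f z‖ₑ + ENNReal.ofReal (v.toFun z) * ‖g z‖ₑ :=
        mul_add _ _ _
    _ ≤ hNorm v f + hNorm v g :=
        add_le_add (le_iSup (fun z => ENNReal.ofReal (v.toFun z) * ‖f z‖ₑ) z)
          (le_iSup (fun z => ENNReal.ofReal (v.toFun z) * ‖g z‖ₑ) z)

theorem hNorm_smul (v : Weight) (c : ℂ) (f : 𝔻 → ℂ) :
    hNorm v (c • f) = ‖c‖ₑ * hNorm v f := by
  simp only [hNorm, ENNReal.mul_iSup, Pi.smul_apply, enorm_smul]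
  exact iSup_congr fun z => by ring

theorem eq_zero_of_hNorm (v : Weight) {f : 𝔻 → ℂ} (h : hNorm v f = 0) : f = 0 := by
  funext z
  have hz := ENNReal.iSup_eq_zero.1 h z
  rcases mul_eq_zero.1 hz with h1 | h1
  · exact absurd (ENNReal.ofReal_eq_zero.1 h1) (not_le.2 (v.pos z))
  · simpa using h1

theorem bNorm_zero (v : Weight) : bNorm v 0 = 0 := by
  simp [bNorm, derivD_zero, hNorm_zero]

theorem bNorm_add_le (v : Weight) {f g : 𝔻 → ℂ} (hf : IsHolo f) (hg : IsHolo g) :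
    bNorm v (f + g) ≤ bNorm v f + bNorm v g := by
  unfold bNorm
  rw [derivD_add hf hg]
  calc ‖(f + g) 0‖ₑ + hNorm v (derivD f + derivD g)
      ≤ (‖f 0‖ₑ + ‖g 0‖ₑ) + (hNorm v (derivD f) + hNorm v (derivD g)) :=
        add_le_add (enorm_add_le _ _) (hNorm_add_le _ _ _)
    _ = _ := by ring

theorem bNorm_smul (v : Weight) (c : ℂ) {f : 𝔻 → ℂ} (hf : IsHolo f) :
    bNorm v (c • f) = ‖c‖ₑ * bNorm v f := by
  simp only [bNorm, derivD_smul c hf, hNorm_smul, Pi.smul_apply, enorm_smul, mul_add]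

/-- The holomorphic functions with `‖f‖_{H_v^∞} < ∞`. -/
def hInfSubmodule (v : Weight) : Submodule ℂ (𝔻 → ℂ) where
  carrier := {f | IsHolo f ∧ hNorm v f < ∞}
  zero_mem' := ⟨isHolo_zero, by simp [hNorm_zero]⟩
  add_mem' hf hg := ⟨hf.1.add hg.1,
    (hNorm_add_le v _ _).trans_lt (ENNReal.add_lt_top.2 ⟨hf.2, hg.2⟩)⟩
  smul_mem' c f hf := ⟨hf.1.smul c, by
    rw [hNorm_smul]
    exact ENNReal.mul_lt_top enorm_lt_top hf.2⟩

/-- The holomorphic functions with `‖f‖_{B^v} < ∞`, equivalently with `f' ∈ H_v^∞`. -/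
def blochSubmodule (v : Weight) : Submodule ℂ (𝔻 → ℂ) where
  carrier := {f | IsHolo f ∧ bNorm v f < ∞}
  zero_mem' := ⟨isHolo_zero, by simp [bNorm_zero]⟩
  add_mem' hf hg := ⟨hf.1.add hg.1,
    (bNorm_add_le v hf.1 hg.1).trans_lt (ENNReal.add_lt_top.2 ⟨hf.2, hg.2⟩)⟩
  smul_mem' c f hf := ⟨hf.1.smul c, by
    rw [bNorm_smul v c hf.1]
    exact ENNReal.mul_lt_top enorm_lt_top hf.2⟩

/-- The growth space `H_v^∞`; its topology is the one of its norm, defined below. -/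
def HInf (v : Weight) : Type := hInfSubmodule v

/-- The Bloch-type space `B^v`; its topology is the one of its norm, defined below. -/
def Bloch (v : Weight) : Type := blochSubmodule v

instance (v : Weight) : AddCommGroup (HInf v) := inferInstanceAs (AddCommGroup (hInfSubmodule v))
instance (v : Weight) : Module ℂ (HInf v) := inferInstanceAs (Module ℂ (hInfSubmodule v))
instance (v : Weight) : AddCommGroup (Bloch v) := inferInstanceAs (AddCommGroup (blochSubmodule v))
instance (v : Weight) : Module ℂ (Bloch v) := inferInstanceAs (Module ℂ (blochSubmodule v))

/-- The function on the disc underlying an element of `H_v^∞`. -/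
def HInf.fn {v : Weight} (f : HInf v) : 𝔻 → ℂ := Subtype.val f

/-- The function on the disc underlying an element of `B^v`. -/
def Bloch.fn {v : Weight} (f : Bloch v) : 𝔻 → ℂ := Subtype.val f

theorem HInf.isHolo {v : Weight} (f : HInf v) : IsHolo f.fn := (Subtype.property f).1
theorem HInf.lt_top {v : Weight} (f : HInf v) : hNorm v f.fn < ∞ := (Subtype.property f).2
theorem Bloch.isHolo {v : Weight} (f : Bloch v) : IsHolo f.fn := (Subtype.property f).1
theorem Bloch.lt_top {v : Weight} (f : Bloch v) : bNorm v f.fn < ∞ := (Subtype.property f).2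

instance (v : Weight) : Norm (HInf v) := ⟨fun f => (hNorm v f.fn).toReal⟩
instance (v : Weight) : Norm (Bloch v) := ⟨fun f => (bNorm v f.fn).toReal⟩

theorem HInf.core (v : Weight) : NormedSpace.Core ℂ (HInf v) where
  norm_nonneg _ := ENNReal.toReal_nonneg
  norm_smul c f := by
    change (hNorm v (c • f.fn)).toReal = ‖c‖ * (hNorm v f.fn).toReal
    rw [hNorm_smul, ENNReal.toReal_mul, toReal_enorm]
  norm_triangle f g := by
    change (hNorm v (f.fn + g.fn)).toReal ≤ (hNorm v f.fn).toReal + (hNorm v g.fn).toReal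
    rw [← ENNReal.toReal_add f.lt_top.ne g.lt_top.ne]
    exact ENNReal.toReal_mono (ENNReal.add_lt_top.2 ⟨f.lt_top, g.lt_top⟩).ne (hNorm_add_le _ _ _)
  norm_eq_zero_iff f := by
    constructor
    · intro h
      have h' : hNorm v f.fn = 0 :=
        ((ENNReal.toReal_eq_zero_iff _).1 h).resolve_right f.lt_top.ne
      exact Subtype.ext (eq_zero_of_hNorm v h')
    · rintro rfl
      change (hNorm v 0).toReal = 0
      rw [hNorm_zero, ENNReal.toReal_zero]

theorem Bloch.core (v : Weight) : NormedSpace.Core ℂ (Bloch v) where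
  norm_nonneg _ := ENNReal.toReal_nonneg
  norm_smul c f := by
    change (bNorm v (c • f.fn)).toReal = ‖c‖ * (bNorm v f.fn).toReal
    rw [bNorm_smul v c f.isHolo, ENNReal.toReal_mul, toReal_enorm]
  norm_triangle f g := by
    change (bNorm v (f.fn + g.fn)).toReal ≤ (bNorm v f.fn).toReal + (bNorm v g.fn).toReal
    rw [← ENNReal.toReal_add f.lt_top.ne g.lt_top.ne]
    exact ENNReal.toReal_mono (ENNReal.add_lt_top.2 ⟨f.lt_top, g.lt_top⟩).ne
      (bNorm_add_le _ f.isHolo g.isHolo)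
  norm_eq_zero_iff f := by
    constructor
    · intro h
      have h' : bNorm v f.fn = 0 :=
        ((ENNReal.toReal_eq_zero_iff _).1 h).resolve_right f.lt_top.ne
      have h2 := add_eq_zero.1 h'
      have h3 : f.fn 0 = 0 := by simpa using h2.1
      exact Subtype.ext (f.isHolo.eq_zero h3 (eq_zero_of_hNorm v h2.2))
    · rintro rfl
      change (bNorm v 0).toReal = 0
      rw [bNorm_zero, ENNReal.toReal_zero]

instance (v : Weight) : NormedAddCommGroup (HInf v) := NormedAddCommGroup.ofCore (HInf.core v)
instance (v : Weight) : NormedSpace ℂ (HInf v) := NormedSpace.ofCore (HInf.core v)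
instance (v : Weight) : NormedAddCommGroup (Bloch v) := NormedAddCommGroup.ofCore (Bloch.core v)
instance (v : Weight) : NormedSpace ℂ (Bloch v) := NormedSpace.ofCore (Bloch.core v)

/-- The logarithmic weight `v_log(z) = (1 - |z|) log (2 / (1 - |z|))`. -/
def vlog : Weight where
  toFun z := (1 - ‖(z : ℂ)‖) * Real.log (2 / (1 - ‖(z : ℂ)‖))
  continuous_toFun := by
    have h1 : Continuous fun z : 𝔻 => 1 - ‖(z : ℂ)‖ :=
      continuous_const.sub (continuous_norm.comp Complex.UnitDisc.continuous_coe)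
    have h2 : ∀ z : 𝔻, 1 - ‖(z : ℂ)‖ ≠ 0 := fun z => (sub_pos.2 z.norm_lt_one).ne'
    exact h1.mul ((continuous_const.div h1 h2).log fun z => div_ne_zero two_ne_zero (h2 z))
  pos z := by
    have h1 : 0 < 1 - ‖(z : ℂ)‖ := sub_pos.2 z.norm_lt_one
    refine mul_pos h1 (Real.log_pos ?_)
    rw [lt_div_iff₀ h1]
    linarith [norm_nonneg (z : ℂ)]
  bounded := by
    refine ⟨2, fun z => ?_⟩
    have h1 : 0 < 1 - ‖(z : ℂ)‖ := sub_pos.2 z.norm_lt_one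
    calc (1 - ‖(z : ℂ)‖) * Real.log (2 / (1 - ‖(z : ℂ)‖))
        ≤ (1 - ‖(z : ℂ)‖) * (2 / (1 - ‖(z : ℂ)‖)) := by
          gcongr
          exact Real.log_le_self (by positivity)
      _ = 2 := by field_simp

theorem one_lt_log_four : 1 < Real.log 4 := by
  rw [Real.lt_log_iff_exp_lt (by norm_num)]
  linarith [Real.exp_one_lt_d9]

theorem log_four_le (z : 𝔻) : Real.log 4 ≤ Real.log (4 / (1 - ‖(z : ℂ)‖ ^ 2)) := by
  have h1 : 0 < 1 - ‖(z : ℂ)‖ ^ 2 := sub_pos.2 z.sq_norm_lt_one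
  refine Real.log_le_log (by norm_num) ?_
  rw [le_div_iff₀ h1]
  nlinarith [sq_nonneg ‖(z : ℂ)‖]

/-- The weight `w_log(z) = [log log (4 / (1 - |z|²))]⁻¹`. -/
def wlog : Weight where
  toFun z := (Real.log (Real.log (4 / (1 - ‖(z : ℂ)‖ ^ 2))))⁻¹
  continuous_toFun := by
    have h1 : Continuous fun z : 𝔻 => 1 - ‖(z : ℂ)‖ ^ 2 :=
      continuous_const.sub ((continuous_norm.comp Complex.UnitDisc.continuous_coe).pow 2)
    have h2 : ∀ z : 𝔻, 1 - ‖(z : ℂ)‖ ^ 2 ≠ 0 := fun z => (sub_pos.2 z.sq_norm_lt_one).ne'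
    have h3 := (continuous_const.div h1 h2).log
      (fun z => div_ne_zero (four_ne_zero (α := ℝ)) (h2 z))
    have h4 : ∀ z : 𝔻, 1 < Real.log (4 / (1 - ‖(z : ℂ)‖ ^ 2)) :=
      fun z => one_lt_log_four.trans_le (log_four_le z)
    exact (h3.log fun z => (zero_lt_one.trans (h4 z)).ne').inv₀
      fun z => (Real.log_pos (h4 z)).ne'
  pos z := inv_pos.2 (Real.log_pos (one_lt_log_four.trans_le (log_four_le z)))
  bounded := by
    refine ⟨(Real.log (Real.log 4))⁻¹, fun z => ?_⟩
    exact inv_anti₀ (Real.log_pos one_lt_log_four)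
      (Real.log_le_log (zero_lt_one.trans one_lt_log_four) (log_four_le z))

/-- `g_n(z) = z^n`. -/
def g (n : ℕ) (z : 𝔻) : ℂ := (z : ℂ) ^ n

/-- The power `φ^n` of a self-map of the disc, that is `z ↦ φ(z)^n`. -/
def powFn (φ : 𝔻 → 𝔻) (n : ℕ) (z : 𝔻) : ℂ := (φ z : ℂ) ^ n

/-- `J_u f(z) = ∫_0^z f(s) u'(s) ds`, the integral being along the segment from `0` to `z`. -/
def J (u f : 𝔻 → ℂ) (z : 𝔻) : ℂ :=
  ∫ t in (0 : ℝ)..1, ext f (t * (z : ℂ)) * ext (derivD u) (t * (z : ℂ)) * (z : ℂ)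

/-- The weighted composition operator `W_{u,φ} f = u · (f ∘ φ)` on functions on the disc. -/
def W (u : 𝔻 → ℂ) (φ : 𝔻 → 𝔻) (f : 𝔻 → ℂ) (z : 𝔻) : ℂ := u z * f (φ z)

/-- The essential norm of a bounded operator: its distance in operator norm to the compact
operators. -/
def essNorm {X Y : Type} [NormedAddCommGroup X] [NormedSpace ℂ X] [NormedAddCommGroup Y]
    [NormedSpace ℂ Y] (T : X →L[ℂ] Y) : ℝ :=
  sInf {r : ℝ | ∃ K : X →L[ℂ] Y, IsCompactOperator K ∧ r = ‖T - K‖}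

/-- `T` is the operator `W_{u,φ} : B^v → H_w^∞`. As `T` is a continuous linear map, the existence
of such a `T` says that `W_{u,φ}` maps `B^v` into `H_w^∞` and is bounded. -/
def IsWeightedComp {v w : Weight} (u : 𝔻 → ℂ) (φ : 𝔻 → 𝔻) (T : Bloch v →L[ℂ] HInf w) : Prop :=
  ∀ f : Bloch v, (T f).fn = W u φ f.fn

end LogBloch

end

open LogBloch

/-!
Write `V = v_log |u|` and `ℓ(x) = log log (4 / (1 - x²))`, so that `1 / w_log(z) = ℓ(|z|)`.

Integrating `|f'| ≤ ‖f‖ / v_log` along radii gives `|f(w)| ≲ ℓ(|w|) ‖f‖` on `B^{v_log}`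
(`Bloch.norm_ext_le`), and Cauchy's estimates then show that the Taylor polynomials of a dilation
`f(ρ² ·)` converge to it uniformly on the disc and on the unit ball of `B^{v_log}`
(`Bloch.norm_sub_taylor_le`). Hence `T = W_{u,φ}` can be compared with the finite-rank operators
obtained by applying `T` to these Taylor polynomials. At points where `|φ(z)|` stays away from `1`
the difference `f(φ(z)) - f(ρ² φ(z))` is `O(1 - ρ)`, and elsewhere it is at most a multiple of
`ℓ(|φ(z)|) ‖f‖`. Letting the degree tend to infinity and then `ρ → 1`, the essential norm is at
most a constant times the supremum of `V(z) ℓ(|φ(z)|)` over the `z` with `|φ(z)| ≥ s`, for every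
`s < 1` (`essNorm_le_of_forall`).

That supremum is recovered from the powers `φⁿ`. For `n` of the order of `1 / (1 - |φ(z)|)` one has
`|φ(z)|ⁿ ≥ 1 / 2` and `‖g_n‖_{w_log} ≲ 1 / ℓ(|φ(z)|)` (`pow_mul_logLog_le`), so that
`V(z) ℓ(|φ(z)|) ≲ ‖u φⁿ‖ / ‖g_n‖` (`exists_forall_weight_mul_le`).

The statement for `W_{u',φ}` reduces to the one for `W_{u,φ}` with `u'` in place of `u`: since
`(J_u f)' = u' f` and `g_{n+1}' = (n + 1) g_n`, the two sequences of quotients agree term by term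
(`succ_mul_bNorm_J_div`).
-/

noncomputable section

namespace LogBloch

/-! ### The iterated logarithm -/

/-- `log log (4 / (1 - x²))`, the reciprocal of the weight `w_log` as a function of `x = |z|`. -/
def logLog (x : ℝ) : ℝ := Real.log (Real.log (4 / (1 - x ^ 2)))

theorem wlog_apply (z : 𝔻) : wlog.toFun z = (logLog ‖(z : ℂ)‖)⁻¹ := rfl

theorem logLog_zero : logLog 0 = Real.log (Real.log 4) := by
  simp [logLog]

theorem logLog_zero_pos : 0 < logLog 0 := by
  rw [logLog_zero]
  exact Real.log_pos one_lt_log_four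

theorem logLog_mono {x y : ℝ} (hx : 0 ≤ x) (hxy : x ≤ y) (hy : y < 1) : logLog x ≤ logLog y := by
  have hx2 : x ^ 2 ≤ y ^ 2 := by gcongr
  have hy2 : y ^ 2 < 1 := by nlinarith
  have h4 : (4 : ℝ) ≤ 4 / (1 - x ^ 2) := by
    rw [le_div_iff₀ (by linarith)]
    nlinarith [sq_nonneg x]
  have hlog : 0 < Real.log (4 / (1 - x ^ 2)) := Real.log_pos (by linarith)
  refine Real.log_le_log hlog (Real.log_le_log (by linarith) ?_)
  exact div_le_div_of_nonneg_left (by norm_num) (by linarith) (by linarith)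

theorem logLog_pos {x : ℝ} (hx : 0 ≤ x) (hx1 : x < 1) : 0 < logLog x :=
  logLog_zero_pos.trans_le (logLog_mono le_rfl hx hx1)

/-- The power `y ^ n` decays like `1 / (1 + n (1 - y))`, while `log log (4 / (1 - x²))` exceeds
`log log (4 / (1 - y²))` by at most the logarithm of `4 (1 + n (1 - y))` when `n` is at least of
the order of `1 / (1 - x)`. -/
theorem pow_mul_logLog_le {x y : ℝ} {n : ℕ} (hx : 0 ≤ x) (hx1 : x < 1) (hy : 0 ≤ y) (hy1 : y < 1)
    (hn : 1 ≤ 2 * (n + 1) * (1 - x)) :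
    y ^ n * logLog x ≤ (1 + 4 / logLog 0) * logLog y := by
  set c := logLog 0 with hc
  have hc0 : 0 < c := logLog_zero_pos
  set m : ℝ := 1 + n * (1 - y) with hm
  have hn0 : (0 : ℝ) ≤ n := n.cast_nonneg
  have hm1 : 1 ≤ m := by nlinarith
  have hpow : y ^ n * m ≤ 1 := by
    have hb : ∀ k : ℕ, y ^ k * (1 + k * (1 - y)) ≤ 1 := by
      intro k
      induction k with
      | zero => simp
      | succ k ih =>
        have hk : (0 : ℝ) ≤ k := k.cast_nonneg
        have hyk : 0 ≤ y ^ k := pow_nonneg hy k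
        calc y ^ (k + 1) * (1 + ((k + 1 : ℕ) : ℝ) * (1 - y))
            = y ^ k * (1 + k * (1 - y)) - y ^ k * ((k + 1) * (1 - y) ^ 2) := by push_cast; ring
          _ ≤ 1 := by
            have : 0 ≤ y ^ k * ((k + 1) * (1 - y) ^ 2) := by positivity
            linarith
    exact hb n
  have hcy : c ≤ logLog y := logLog_mono le_rfl hy hy1
  have hx2 : 0 < 1 - x ^ 2 := by nlinarith
  have hy2 : 0 < 1 - y ^ 2 := by nlinarith
  have hA : 4 / (1 - x ^ 2) ≤ 4 * m * (4 / (1 - y ^ 2)) := by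
    have h1 : 1 - y ^ 2 ≤ 4 * m * (1 - x ^ 2) := by
      have h2 : 1 - y ^ 2 ≤ 2 * (1 - y) := by nlinarith
      have h3 : 1 - x ≤ 1 - x ^ 2 := by nlinarith
      have h4 : (n + 1) * (1 - y) ≤ m := by rw [hm]; nlinarith
      have h5 : 1 - y ≤ 2 * m * (1 - x) := by
        calc 1 - y ≤ 2 * (n + 1) * (1 - x) * (1 - y) := by nlinarith
          _ = 2 * ((n + 1) * (1 - y)) * (1 - x) := by ring
          _ ≤ 2 * m * (1 - x) := by gcongr
      have h6 : m * (1 - x) ≤ m * (1 - x ^ 2) := by gcongr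
      linarith
    rw [mul_div_assoc', div_le_div_iff₀ hx2 hy2]
    linarith
  have hBpos : 0 < 4 / (1 - y ^ 2) := by positivity
  have hlogB : 1 ≤ Real.log (4 / (1 - y ^ 2)) := by
    refine one_lt_log_four.le.trans (Real.log_le_log (by norm_num) ?_)
    rw [le_div_iff₀ hy2]
    nlinarith [sq_nonneg y]
  have hlogA : 0 < Real.log (4 / (1 - x ^ 2)) := by
    refine Real.log_pos ?_
    rw [lt_div_iff₀ hx2]
    nlinarith [sq_nonneg x]
  have h7 : Real.log (4 / (1 - x ^ 2)) ≤ 4 * m * Real.log (4 / (1 - y ^ 2)) := by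
    calc Real.log (4 / (1 - x ^ 2)) ≤ Real.log (4 * m * (4 / (1 - y ^ 2))) :=
          Real.log_le_log (by positivity) hA
      _ = Real.log (4 * m) + Real.log (4 / (1 - y ^ 2)) :=
          Real.log_mul (by positivity) hBpos.ne'
      _ ≤ (4 * m - 1) + Real.log (4 / (1 - y ^ 2)) := by
          gcongr
          exact Real.log_le_sub_one_of_pos (by positivity)
      _ ≤ 4 * m * Real.log (4 / (1 - y ^ 2)) := by nlinarith
  have h8 : logLog x ≤ 4 * m + logLog y := by
    calc logLog x ≤ Real.log (4 * m * Real.log (4 / (1 - y ^ 2))) := Real.log_le_log hlogA h7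
      _ = Real.log (4 * m) + logLog y := Real.log_mul (by positivity) (by linarith)
      _ ≤ 4 * m + logLog y := by
          gcongr
          exact Real.log_le_self (by positivity)
  have h9 : logLog x ≤ m * ((1 + 4 / c) * logLog y) := by
    have h10 : 4 * m ≤ m * (4 / c * logLog y) := by
      have : 4 ≤ 4 / c * logLog y := by
        rw [div_mul_eq_mul_div, le_div_iff₀ hc0]
        linarith
      nlinarith
    nlinarith [hc0.trans_le hcy]
  calc y ^ n * logLog x ≤ y ^ n * (m * ((1 + 4 / c) * logLog y)) := by gcongr
    _ = y ^ n * m * ((1 + 4 / c) * logLog y) := by ring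
    _ ≤ 1 * ((1 + 4 / c) * logLog y) := by
        have := hc0.trans_le hcy
        gcongr
    _ = _ := one_mul _

/-! ### Pointwise bounds from the norms -/

theorem hNorm_le_ofReal_iff {v : Weight} {f : 𝔻 → ℂ} {R : ℝ} (hR : 0 ≤ R) :
    hNorm v f ≤ ENNReal.ofReal R ↔ ∀ z, v.toFun z * ‖f z‖ ≤ R := by
  simp only [hNorm, iSup_le_iff]
  refine forall_congr' fun z => ?_
  rw [← ofReal_norm, ← ENNReal.ofReal_mul (v.pos z).le, ENNReal.ofReal_le_ofReal_iff hR]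

theorem HInf.norm_def {v : Weight} (f : HInf v) : ‖f‖ = (hNorm v f.fn).toReal := rfl

theorem Bloch.norm_def {v : Weight} (f : Bloch v) : ‖f‖ = (bNorm v f.fn).toReal := rfl

theorem HInf.norm_le_iff {v : Weight} {f : HInf v} {R : ℝ} (hR : 0 ≤ R) :
    ‖f‖ ≤ R ↔ ∀ z, v.toFun z * ‖f.fn z‖ ≤ R := by
  rw [← hNorm_le_ofReal_iff hR, HInf.norm_def, ENNReal.le_ofReal_iff_toReal_le f.lt_top.ne hR]

theorem HInf.weight_mul_norm_le {v : Weight} (f : HInf v) (z : 𝔻) :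
    v.toFun z * ‖f.fn z‖ ≤ ‖f‖ :=
  (HInf.norm_le_iff (norm_nonneg f)).1 le_rfl z

theorem Bloch.bNorm_eq_ofReal {v : Weight} (f : Bloch v) :
    bNorm v f.fn = ENNReal.ofReal ‖f‖ :=
  (ENNReal.ofReal_toReal f.lt_top.ne).symm

theorem Bloch.norm_apply_zero_le {v : Weight} (f : Bloch v) : ‖f.fn 0‖ ≤ ‖f‖ := by
  have h : ‖f.fn 0‖ₑ ≤ ENNReal.ofReal ‖f‖ := by
    rw [← f.bNorm_eq_ofReal]
    exact le_self_add
  rwa [← ofReal_norm, ENNReal.ofReal_le_ofReal_iff (norm_nonneg f)] at h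

theorem Bloch.weight_mul_norm_derivD_le {v : Weight} (f : Bloch v) (z : 𝔻) :
    v.toFun z * ‖derivD f.fn z‖ ≤ ‖f‖ := by
  refine (hNorm_le_ofReal_iff (norm_nonneg f)).1 ?_ z
  rw [← f.bNorm_eq_ofReal]
  exact le_add_self

theorem log_two_div_pos {x : ℝ} (hx : 0 ≤ x) (hx1 : x < 1) : 0 < Real.log (2 / (1 - x)) := by
  refine Real.log_pos ?_
  rw [lt_div_iff₀ (by linarith)]
  linarith

theorem Bloch.norm_deriv_ext_le (f : Bloch vlog) {z : ℂ} (hz : ‖z‖ < 1) :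
    ‖deriv (ext f.fn) z‖ ≤ ‖f‖ * ((1 - ‖z‖)⁻¹ / Real.log (2 / (1 - ‖z‖))) := by
  have h := f.weight_mul_norm_derivD_le (Complex.UnitDisc.mk z hz)
  have h1 : 0 < 1 - ‖z‖ := by linarith
  have h2 := log_two_div_pos (norm_nonneg z) hz
  change (1 - ‖z‖) * Real.log (2 / (1 - ‖z‖)) * ‖deriv (ext f.fn) z‖ ≤ ‖f‖ at h
  rw [inv_eq_one_div, div_div, mul_one_div, le_div_iff₀ (by positivity)]
  linarith

theorem hasDerivAt_log_log {x : ℝ} (hx : 0 ≤ x) (hx1 : x < 1) :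
    HasDerivAt (fun t : ℝ => Real.log (Real.log (2 / (1 - t))))
      ((1 - x)⁻¹ / Real.log (2 / (1 - x))) x := by
  have h1 : (1 - x) ≠ 0 := by linarith
  have h3 : HasDerivAt (fun t : ℝ => 2 / (1 - t)) (2 / (1 - x) ^ 2) x := by
    simpa using (hasDerivAt_const x (2 : ℝ)).fun_div ((hasDerivAt_id x).const_sub 1) h1
  have h4 := (h3.log (div_ne_zero two_ne_zero h1)).log (log_two_div_pos hx hx1).ne'
  convert h4 using 1
  field_simp

theorem log_log_two_nonpos : Real.log (Real.log 2) ≤ 0 :=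
  Real.log_nonpos (Real.log_nonneg one_le_two) (by linarith [Real.log_two_lt_d9])

/-- A constant bounding point evaluation on `B^{v_log}` relative to `1 / w_log`. -/
def growthConst : ℝ := 1 + (1 - Real.log (Real.log 2)) / logLog 0

/-- Integrating the bound on `f'` along a radius bounds `f` by a multiple of `1 / w_log`. -/
theorem Bloch.norm_ext_le (f : Bloch vlog) {z : ℂ} (hz : ‖z‖ < 1) :
    ‖ext f.fn z‖ ≤ growthConst * logLog ‖z‖ * ‖f‖ := by
  have hball : ∀ t ∈ Set.Icc (0 : ℝ) 1, ‖(t : ℂ) * z‖ < 1 := by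
    intro t ht
    rw [norm_mul, Complex.norm_real, Real.norm_of_nonneg ht.1]
    nlinarith [ht.2, norm_nonneg z]
  have hd : ∀ t ∈ Set.Icc (0 : ℝ) 1, HasDerivAt (fun s : ℝ => ext f.fn (s * z))
      (deriv (ext f.fn) (t * z) * z) t := by
    intro t ht
    have h1 : HasDerivAt (ext f.fn) (deriv (ext f.fn) (t * z)) (t * z) :=
      (f.isHolo.differentiableAt (Complex.UnitDisc.mk _ (hball t ht))).hasDerivAt
    have h2 : HasDerivAt (fun s : ℂ => s * z) z (t : ℂ) := by
      simpa using (hasDerivAt_id (t : ℂ)).mul_const z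
    exact (HasDerivAt.comp (t : ℂ) h1 h2).comp_ofReal
  have hB : ∀ t ∈ Set.Icc (0 : ℝ) 1,
      HasDerivAt (fun s : ℝ => ‖f‖ * (1 + Real.log (Real.log (2 / (1 - s * ‖z‖)))
        - Real.log (Real.log 2)))
        (‖f‖ * ((1 - t * ‖z‖)⁻¹ / Real.log (2 / (1 - t * ‖z‖)) * ‖z‖)) t := by
    intro t ht
    have h1 : HasDerivAt (fun s : ℝ => s * ‖z‖) ‖z‖ t := by
      simpa using (hasDerivAt_id t).mul_const ‖z‖
    have ht1 : t * ‖z‖ < 1 := by nlinarith [ht.2, norm_nonneg z]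
    have h2 := hasDerivAt_log_log (mul_nonneg ht.1 (norm_nonneg z)) ht1
    exact ((((HasDerivAt.comp t h2 h1).const_add 1).sub_const _).const_mul ‖f‖)
  have key := image_norm_le_of_norm_deriv_right_le_deriv_boundary'
    (f := fun s : ℝ => ext f.fn (s * z)) (a := 0) (b := 1)
    (fun t ht => (hd t ht).continuousAt.continuousWithinAt)
    (fun t ht => (hd t (Set.Ico_subset_Icc_self ht)).hasDerivWithinAt)
    (B := fun s : ℝ => ‖f‖ * (1 + Real.log (Real.log (2 / (1 - s * ‖z‖)))
        - Real.log (Real.log 2)))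
    (by
      have h0 : ext f.fn 0 = f.fn 0 := ext_coe f.fn 0
      simpa [h0] using f.norm_apply_zero_le)
    (fun t ht => (hB t ht).continuousAt.continuousWithinAt)
    (fun t ht => (hB t (Set.Ico_subset_Icc_self ht)).hasDerivWithinAt)
    (by
      intro t ht
      have hn : ‖(t : ℂ) * z‖ = t * ‖z‖ := by
        rw [norm_mul, Complex.norm_real, Real.norm_of_nonneg ht.1]
      have h1 := f.norm_deriv_ext_le (hball t (Set.Ico_subset_Icc_self ht))
      rw [hn] at h1
      rw [norm_mul, ← mul_assoc]
      gcongr)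
    (Set.right_mem_Icc.2 zero_le_one)
  simp only [Complex.ofReal_one, one_mul] at key
  have hz0 := norm_nonneg z
  have h1 : Real.log (Real.log (2 / (1 - ‖z‖))) ≤ logLog ‖z‖ := by
    refine Real.log_le_log (log_two_div_pos hz0 hz)
      (Real.log_le_log (div_pos two_pos (by linarith)) ?_)
    rw [div_le_div_iff₀ (by linarith) (by nlinarith)]
    nlinarith
  have h2 : logLog 0 ≤ logLog ‖z‖ := logLog_mono le_rfl hz0 hz
  have h3 : 0 ≤ 1 - Real.log (Real.log 2) := by
    linarith [log_log_two_nonpos]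
  have h4 : 1 - Real.log (Real.log 2) ≤
      (1 - Real.log (Real.log 2)) / logLog 0 * logLog ‖z‖ := by
    rw [div_mul_eq_mul_div, le_div_iff₀ logLog_zero_pos]
    gcongr
  calc ‖ext f.fn z‖ ≤ _ := key
    _ ≤ ‖f‖ * (growthConst * logLog ‖z‖) := by
        gcongr
        rw [growthConst]
        linarith
    _ = _ := by ring

/-- A Bloch function is Lipschitz on each smaller disc. -/
theorem Bloch.norm_sub_ext_le (f : Bloch vlog) {s : ℝ} (hs : s < 1) {x y : ℂ} (hx : ‖x‖ ≤ s)
    (hy : ‖y‖ ≤ s) :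
    ‖ext f.fn x - ext f.fn y‖ ≤ ‖f‖ * ((1 - s)⁻¹ / Real.log 2) * ‖x - y‖ := by
  refine (convex_closedBall (0 : ℂ) s).norm_image_sub_le_of_norm_deriv_le (𝕜 := ℂ)
    (fun w hw => ?_) (fun w hw => ?_) (by simpa using hy) (by simpa using hx)
  · have hw1 : ‖w‖ < 1 := (mem_closedBall_zero_iff.1 hw).trans_lt hs
    exact f.isHolo.differentiableAt (Complex.UnitDisc.mk w hw1)
  · have hws : ‖w‖ ≤ s := mem_closedBall_zero_iff.1 hw
    have hw1 : ‖w‖ < 1 := hws.trans_lt hs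
    refine (f.norm_deriv_ext_le hw1).trans ?_
    have h2 : 0 < Real.log 2 := Real.log_pos one_lt_two
    have h3 : (2 : ℝ) ≤ 2 / (1 - ‖w‖) := by
      rw [le_div_iff₀ (by linarith)]
      linarith [norm_nonneg w]
    have h4 : 0 < 1 - s := by linarith
    have h5 : 0 ≤ 1 - ‖w‖ := by linarith
    gcongr

/-! ### Taylor coefficients and finite-rank approximation -/

/-- The `k`-th Taylor coefficient at `0`, as a linear functional on `B^{v_log}`. -/
def coeffₗ (k : ℕ) : Bloch vlog →ₗ[ℂ] ℂ where
  toFun f := (k.factorial : ℂ)⁻¹ * iteratedDeriv k (ext f.fn) 0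
  map_add' f h := by
    have hc : ∀ p : Bloch vlog, ContDiffAt ℂ k (ext p.fn) 0 := fun p =>
      (p.isHolo.analyticAt (Metric.isOpen_ball.mem_nhds (by simp))).contDiffAt
    change _ * iteratedDeriv k (ext (f.fn + h.fn)) 0 = _
    rw [ext_add, iteratedDeriv_add (hc f) (hc h), mul_add]
  map_smul' c f := by
    change _ * iteratedDeriv k (ext (c • f.fn)) 0 = _
    rw [ext_smul, iteratedDeriv_const_smul_field]
    simp only [smul_eq_mul, RingHom.id_apply]
    ring

theorem norm_coeffₗ_le (k : ℕ) {ρ : ℝ} (hρ : 0 < ρ) (hρ1 : ρ < 1) (f : Bloch vlog) :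
    ‖coeffₗ k f‖ ≤ (growthConst * logLog ρ) / ρ ^ k * ‖f‖ := by
  have hd : DiffContOnCl ℂ (ext f.fn) (Metric.ball 0 ρ) := by
    refine DifferentiableOn.diffContOnCl ?_
    rw [closure_ball _ hρ.ne']
    exact f.isHolo.mono (Metric.closedBall_subset_ball hρ1)
  have h := Complex.norm_iteratedDeriv_le_of_forall_mem_sphere_norm_le k hρ hd
    (fun z hz => by
      have hz' : ‖z‖ = ρ := by simpa using hz
      have := f.norm_ext_le (z := z) (by rw [hz']; exact hρ1)
      rwa [hz'] at this)
  have hk : (0 : ℝ) < k.factorial := by exact_mod_cast k.factorial_pos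
  change ‖(k.factorial : ℂ)⁻¹ * iteratedDeriv k (ext f.fn) 0‖ ≤ _
  rw [norm_mul, norm_inv, Complex.norm_natCast, inv_mul_le_iff₀ hk]
  refine h.trans_eq ?_
  ring

/-- The `k`-th Taylor coefficient at `0`, as a bounded linear functional on `B^{v_log}`. -/
def coeffL (k : ℕ) : Bloch vlog →L[ℂ] ℂ :=
  (coeffₗ k).mkContinuous _ (norm_coeffₗ_le k (ρ := 1 / 2) (by norm_num) (by norm_num))

theorem hasSum_coeffL (f : Bloch vlog) {z : ℂ} (hz : ‖z‖ < 1) :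
    HasSum (fun k => coeffL k f * z ^ k) (ext f.fn z) := by
  have h := Complex.hasSum_taylorSeries_on_ball f.isHolo (mem_ball_zero_iff.2 hz)
  refine h.congr_fun fun k => ?_
  change (k.factorial : ℂ)⁻¹ * iteratedDeriv k (ext f.fn) 0 * z ^ k = _
  simp only [sub_zero, smul_eq_mul]
  ring

/-- The dilation `f(ρ² ·)` is approximated by its Taylor polynomials, uniformly on the disc and on
the unit ball of `B^{v_log}`. -/
theorem Bloch.norm_sub_taylor_le (f : Bloch vlog) {ρ : ℝ} (hρ : 0 < ρ) (hρ1 : ρ < 1) {z : ℂ}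
    (hz : ‖z‖ < 1) (N : ℕ) :
    ‖ext f.fn ((ρ ^ 2 : ℝ) * z) -
        ∑ k ∈ Finset.range N, ((ρ ^ 2 : ℝ) : ℂ) ^ k * (coeffL k f * z ^ k)‖ ≤
      (growthConst * logLog ρ) * (1 - ρ)⁻¹ * ρ ^ N * ‖f‖ := by
  set A := growthConst * logLog ρ with hA
  have hnorm : ‖((ρ ^ 2 : ℝ) : ℂ) * z‖ < 1 := by
    rw [norm_mul, Complex.norm_real, Real.norm_of_nonneg (by positivity)]
    nlinarith [norm_nonneg z]
  have hs := hasSum_coeffL f hnorm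
  have hterm : ∀ k, ‖coeffL k f * (((ρ ^ 2 : ℝ) : ℂ) * z) ^ k‖ ≤ A * ‖f‖ * ρ ^ k := by
    intro k
    have h1 : ‖coeffL k f‖ ≤ A / ρ ^ k * ‖f‖ := norm_coeffₗ_le k hρ hρ1 f
    have h2 : ‖(((ρ ^ 2 : ℝ) : ℂ) * z) ^ k‖ ≤ ρ ^ k * ρ ^ k := by
      rw [norm_pow, norm_mul, Complex.norm_real, Real.norm_of_nonneg (by positivity), ← mul_pow]
      exact pow_le_pow_left₀ (by positivity) (by nlinarith [norm_nonneg z, sq_nonneg ρ]) k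
    calc ‖coeffL k f * (((ρ ^ 2 : ℝ) : ℂ) * z) ^ k‖
        ≤ (A / ρ ^ k * ‖f‖) * (ρ ^ k * ρ ^ k) := by
          rw [norm_mul]
          exact mul_le_mul h1 h2 (norm_nonneg _) ((norm_nonneg _).trans h1)
      _ = A * ‖f‖ * ρ ^ k := by field_simp
  have htail := (hasSum_nat_add_iff' N).2 hs
  have hgeo : HasSum (fun k => A * ‖f‖ * ρ ^ (k + N)) (A * ‖f‖ * ρ ^ N * (1 - ρ)⁻¹) :=
    ((hasSum_geometric_of_lt_one hρ.le hρ1).mul_left (A * ‖f‖ * ρ ^ N)).congr_fun fun k => by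
      rw [pow_add]
      ring
  have hsum : ∑ k ∈ Finset.range N, ((ρ ^ 2 : ℝ) : ℂ) ^ k * (coeffL k f * z ^ k) =
      ∑ k ∈ Finset.range N, coeffL k f * (((ρ ^ 2 : ℝ) : ℂ) * z) ^ k :=
    Finset.sum_congr rfl fun k _ => by
      rw [mul_pow]
      ring
  rw [hsum]
  refine (HasSum.norm_le_of_bounded htail hgeo fun k => hterm (k + N)).trans_eq ?_
  ring

/-! ### Powers of the coordinate -/

theorem eqOn_ext {f : 𝔻 → ℂ} {F : ℂ → ℂ} (h : ∀ z : 𝔻, f z = F z) :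
    Set.EqOn (ext f) F (Metric.ball 0 1) := fun z hz => by
  have hz' : ‖z‖ < 1 := mem_ball_zero_iff.1 hz
  exact (ext_coe f (Complex.UnitDisc.mk z hz')).trans (h _)

theorem isHolo_of_eq {f : 𝔻 → ℂ} {F : ℂ → ℂ} (h : ∀ z : 𝔻, f z = F z)
    (hF : DifferentiableOn ℂ F (Metric.ball 0 1)) : IsHolo f :=
  hF.congr (eqOn_ext h)

theorem derivD_of_eq {f : 𝔻 → ℂ} {F : ℂ → ℂ} (h : ∀ z : 𝔻, f z = F z) (z : 𝔻) :
    derivD f z = deriv F z :=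
  ((eqOn_ext h).eventuallyEq_of_mem
    (Metric.isOpen_ball.mem_nhds (by simpa using z.norm_lt_one))).deriv_eq

theorem isHolo_g (n : ℕ) : IsHolo (g n) :=
  isHolo_of_eq (F := fun z => z ^ n) (fun _ => rfl) (differentiable_pow n).differentiableOn

theorem derivD_g (n : ℕ) (z : 𝔻) : derivD (g n) z = n * (z : ℂ) ^ (n - 1) := by
  exact (derivD_of_eq (F := fun z => z ^ n) (fun _ => rfl) z).trans (by simp)

theorem norm_coe_pow_le_one (z : 𝔻) (n : ℕ) : ‖(z : ℂ) ^ n‖ ≤ 1 := by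
  rw [norm_pow]
  exact pow_le_one₀ (norm_nonneg _) z.norm_lt_one.le

theorem hNorm_g_lt_top (v : Weight) (n : ℕ) : hNorm v (g n) < ∞ := by
  obtain ⟨M, hM⟩ := v.bounded
  have hM0 : 0 ≤ M := (v.pos 0).le.trans (hM 0)
  refine ((hNorm_le_ofReal_iff hM0).2 fun z => ?_).trans_lt ENNReal.ofReal_lt_top
  exact (mul_le_of_le_one_right (v.pos z).le (norm_coe_pow_le_one z n)).trans (hM z)

theorem derivD_g_succ (n : ℕ) : derivD (g (n + 1)) = ((n : ℂ) + 1) • g n := by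
  funext z
  simp [derivD_g, g]

theorem bNorm_g_succ (v : Weight) (n : ℕ) : bNorm v (g (n + 1)) = (n + 1) * hNorm v (g n) := by
  have h : ‖(n : ℂ) + 1‖ₑ = (n : ℝ≥0∞) + 1 := by
    rw [← ofReal_norm]
    have : ‖((n + 1 : ℕ) : ℂ)‖ = ((n + 1 : ℕ) : ℝ) := Complex.norm_natCast _
    rw [← Nat.cast_succ, this, ENNReal.ofReal_natCast]
    push_cast
    rfl
  rw [bNorm, derivD_g_succ, hNorm_smul, h]
  simp [g]

theorem bNorm_g_lt_top (v : Weight) (n : ℕ) : bNorm v (g n) < ∞ := by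
  cases n with
  | zero =>
    have h : derivD (g 0) = 0 := by
      funext z
      simp [derivD_g]
    simp [bNorm, h, hNorm_zero]
  | succ n =>
    rw [bNorm_g_succ]
    exact ENNReal.mul_lt_top (by finiteness) (hNorm_g_lt_top v n)

/-- The function `z ↦ zⁿ` as an element of `B^v`. -/
def gBloch (v : Weight) (n : ℕ) : Bloch v := ⟨g n, isHolo_g n, bNorm_g_lt_top v n⟩

/-! ### Bounding the essential norm near the boundary -/

section EssNorm

variable {X Y : Type} [NormedAddCommGroup X] [NormedSpace ℂ X] [NormedAddCommGroup Y]
  [NormedSpace ℂ Y]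

theorem essNorm_le_norm_sub (T K : X →L[ℂ] Y) (hK : IsCompactOperator K) :
    essNorm T ≤ ‖T - K‖ :=
  csInf_le ⟨0, by rintro r ⟨L, -, rfl⟩; exact norm_nonneg _⟩ ⟨K, hK, rfl⟩

theorem isCompactOperator_smulRight (a : X →L[ℂ] ℂ) (y : Y) :
    IsCompactOperator (a.smulRight y) :=
  (isCompactOperator_of_locallyCompactSpace_rng
    (ContinuousLinearMap.toSpanSingleton ℂ y)).comp_clm a

theorem isCompactOperator_sum {ι : Type*} (s : Finset ι) (K : ι → X →L[ℂ] Y)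
    (hK : ∀ i ∈ s, IsCompactOperator (K i)) :
    IsCompactOperator (∑ i ∈ s, K i : X →L[ℂ] Y) :=
  (compactOperator (RingHom.id ℂ) X Y).sum_mem hK

end EssNorm

/-- Evaluation at a point of the disc, as a linear functional on `H_v^∞`. -/
def HInf.evalₗ (v : Weight) (z : 𝔻) : HInf v →ₗ[ℂ] ℂ where
  toFun f := f.fn z
  map_add' _ _ := rfl
  map_smul' _ _ := rfl

/-- The finite-rank operator `f ↦ T (S_N (f (r ·)))`, with `S_N` the Taylor polynomial of degree
less than `N`. -/
def taylorOp {w : Weight} (T : Bloch vlog →L[ℂ] HInf w) (r : ℝ) (N : ℕ) :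
    Bloch vlog →L[ℂ] HInf w :=
  ∑ k ∈ Finset.range N, (r : ℂ) ^ k • (coeffL k).smulRight (T (gBloch vlog k))

theorem isCompactOperator_taylorOp {w : Weight} (T : Bloch vlog →L[ℂ] HInf w) (r : ℝ) (N : ℕ) :
    IsCompactOperator (taylorOp T r N) :=
  isCompactOperator_sum _ _ fun _ _ => (isCompactOperator_smulRight _ _).smul (_ : ℂ)

theorem sub_taylorOp_fn {w : Weight} {u : 𝔻 → ℂ} {φ : 𝔻 → 𝔻} {T : Bloch vlog →L[ℂ] HInf w}
    (hT : IsWeightedComp u φ T) (r : ℝ) (N : ℕ) (f : Bloch vlog) (z : 𝔻) :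
    ((T - taylorOp T r N) f).fn z = u z * (f.fn (φ z) -
      ∑ k ∈ Finset.range N, (r : ℂ) ^ k * (coeffL k f * (φ z : ℂ) ^ k)) := by
  have hTz : ∀ h : Bloch vlog, HInf.evalₗ w z (T h) = u z * h.fn (φ z) :=
    fun h => congrFun (hT h) z
  change HInf.evalₗ w z (T f - taylorOp T r N f) = _
  rw [map_sub, hTz, mul_sub, taylorOp, sum_apply, map_sum, Finset.mul_sum]
  refine congrArg _ (Finset.sum_congr rfl fun k _ => ?_)
  simp only [smul_apply, ContinuousLinearMap.smulRight_apply, map_smul, hTz,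
    smul_eq_mul]
  change (r : ℂ) ^ k * (coeffL k f * (u z * (φ z : ℂ) ^ k)) = _
  ring

theorem growthConst_pos : 0 < growthConst := by
  have h := log_log_two_nonpos
  have : 0 ≤ (1 - Real.log (Real.log 2)) / logLog 0 :=
    div_nonneg (by linarith) logLog_zero_pos.le
  rw [growthConst]
  linarith

/-- The distance of a weighted composition operator to the finite-rank operator `taylorOp`: near
the boundary `f` and its dilation are both controlled by the growth of Bloch functions, and on the
rest of the disc they are uniformly close. -/
theorem essNorm_le_add {u : 𝔻 → ℂ} {φ : 𝔻 → 𝔻} {T : Bloch vlog →L[ℂ] HInf vlog}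
    (hT : IsWeightedComp u φ T) {D s : ℝ} (hs : s < 1) (hD : 0 ≤ D)
    (h : ∀ z, s ≤ ‖(φ z : ℂ)‖ → vlog.toFun z * ‖u z‖ * logLog ‖(φ z : ℂ)‖ ≤ D)
    {ρ : ℝ} (hρ : 0 < ρ) (hρ1 : ρ < 1) (N : ℕ) :
    essNorm T ≤ 2 * growthConst * D +
      ‖T (gBloch vlog 0)‖ * ((1 - s)⁻¹ / Real.log 2 * (1 - ρ ^ 2)) +
      ‖T (gBloch vlog 0)‖ * (growthConst * logLog ρ * (1 - ρ)⁻¹ * ρ ^ N) := by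
  have hG := growthConst_pos
  have hlogρ : 0 < logLog ρ := logLog_pos hρ.le hρ1
  have hlog2 : 0 < Real.log 2 := Real.log_pos one_lt_two
  have hs1 : 0 < 1 - s := by linarith
  have hρ2 : ρ ^ 2 < 1 := by nlinarith
  have hρ2' : 0 < 1 - ρ ^ 2 := by linarith
  have hρ1' : 0 < 1 - ρ := by linarith
  refine (essNorm_le_norm_sub T (taylorOp T (ρ ^ 2) N)
    (isCompactOperator_taylorOp T (ρ ^ 2) N)).trans ?_
  set M := ‖T (gBloch vlog 0)‖ with hM
  have hM0 : 0 ≤ M := norm_nonneg _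
  refine ContinuousLinearMap.opNorm_le_bound _ (by positivity) fun f => ?_
  refine (HInf.norm_le_iff (by positivity)).2 fun z => ?_
  rw [sub_taylorOp_fn hT, norm_mul, ← mul_assoc]
  set V := vlog.toFun z * ‖u z‖ with hV
  have hV0 : 0 ≤ V := mul_nonneg (vlog.pos z).le (norm_nonneg _)
  have hVM : V ≤ M := by
    have h1 := (T (gBloch vlog 0)).weight_mul_norm_le z
    have h2 : (T (gBloch vlog 0)).fn z = u z * (φ z : ℂ) ^ 0 := congrFun (hT _) z
    rwa [h2, pow_zero, mul_one] at h1
  have hw : ‖(φ z : ℂ)‖ < 1 := (φ z).norm_lt_one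
  have hw0 := norm_nonneg (φ z : ℂ)
  have hrw : ‖((ρ ^ 2 : ℝ) : ℂ) * (φ z : ℂ)‖ = ρ ^ 2 * ‖(φ z : ℂ)‖ := by
    rw [norm_mul, Complex.norm_real, Real.norm_of_nonneg (by positivity)]
  have hrw_le : ρ ^ 2 * ‖(φ z : ℂ)‖ ≤ ‖(φ z : ℂ)‖ := mul_le_of_le_one_left hw0 hρ2.le
  have htay := f.norm_sub_taylor_le hρ hρ1 hw N
  have hdil : V * ‖ext f.fn (φ z) - ext f.fn ((ρ ^ 2 : ℝ) * (φ z : ℂ))‖ ≤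
      (2 * growthConst * D + M * ((1 - s)⁻¹ / Real.log 2 * (1 - ρ ^ 2))) * ‖f‖ := by
    by_cases hsz : s ≤ ‖(φ z : ℂ)‖
    · have h1 := f.norm_ext_le hw
      have h2 := f.norm_ext_le (hrw.trans_lt (hrw_le.trans_lt hw))
      rw [hrw] at h2
      have h3 := logLog_mono (by positivity) hrw_le hw
      have h4 : ‖ext f.fn (φ z) - ext f.fn ((ρ ^ 2 : ℝ) * (φ z : ℂ))‖ ≤
          2 * growthConst * logLog ‖(φ z : ℂ)‖ * ‖f‖ := by
        calc _ ≤ _ := norm_sub_le _ _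
          _ ≤ growthConst * logLog ‖(φ z : ℂ)‖ * ‖f‖ +
              growthConst * logLog ‖(φ z : ℂ)‖ * ‖f‖ := by
            refine add_le_add h1 (h2.trans ?_)
            gcongr
          _ = _ := by ring
      calc _ ≤ V * (2 * growthConst * logLog ‖(φ z : ℂ)‖ * ‖f‖) := by gcongr
        _ = 2 * growthConst * (V * logLog ‖(φ z : ℂ)‖) * ‖f‖ := by ring
        _ ≤ 2 * growthConst * D * ‖f‖ := by
          gcongr
          exact h z hsz
        _ ≤ _ := by
          gcongr
          exact le_add_of_nonneg_right (by positivity)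
    · have hws : ‖(φ z : ℂ)‖ ≤ s := (not_le.1 hsz).le
      have h1 := f.norm_sub_ext_le hs hws (hrw.trans_le (hrw_le.trans hws))
      have h2 : ‖(φ z : ℂ) - ((ρ ^ 2 : ℝ) : ℂ) * (φ z : ℂ)‖ ≤ 1 - ρ ^ 2 := by
        have : (φ z : ℂ) - ((ρ ^ 2 : ℝ) : ℂ) * (φ z : ℂ) = ((1 - ρ ^ 2 : ℝ) : ℂ) * (φ z : ℂ) := by
          push_cast
          ring
        rw [this, norm_mul, Complex.norm_real, Real.norm_of_nonneg hρ2'.le]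
        exact mul_le_of_le_one_right hρ2'.le hw.le
      calc _ ≤ M * (‖f‖ * ((1 - s)⁻¹ / Real.log 2) * (1 - ρ ^ 2)) :=
            mul_le_mul hVM (h1.trans (by gcongr)) (norm_nonneg _) hM0
        _ = M * ((1 - s)⁻¹ / Real.log 2 * (1 - ρ ^ 2)) * ‖f‖ := by ring
        _ ≤ _ := by
          gcongr
          exact le_add_of_nonneg_left (by positivity)
  rw [← ext_coe f.fn (φ z)]
  calc _ ≤ V * (‖ext f.fn (φ z) - ext f.fn ((ρ ^ 2 : ℝ) * (φ z : ℂ))‖ + _) := by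
        gcongr
        exact norm_sub_le_norm_sub_add_norm_sub _ (ext f.fn ((ρ ^ 2 : ℝ) * (φ z : ℂ))) _
    _ ≤ (2 * growthConst * D + M * ((1 - s)⁻¹ / Real.log 2 * (1 - ρ ^ 2))) * ‖f‖ +
        M * (growthConst * logLog ρ * (1 - ρ)⁻¹ * ρ ^ N * ‖f‖) := by
        rw [mul_add]
        exact add_le_add hdil (mul_le_mul hVM htay (norm_nonneg _) hM0)
    _ = _ := by ring

/-- The essential norm of `W_{u,φ}` is governed by the size of `v_log |u| / (w_log ∘ φ)` where `φ`
is close to the unit circle. -/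
theorem essNorm_le_of_forall {u : 𝔻 → ℂ} {φ : 𝔻 → 𝔻} {T : Bloch vlog →L[ℂ] HInf vlog}
    (hT : IsWeightedComp u φ T) {D s : ℝ} (hs : s < 1) (hD : 0 ≤ D)
    (h : ∀ z, s ≤ ‖(φ z : ℂ)‖ → vlog.toFun z * ‖u z‖ * logLog ‖(φ z : ℂ)‖ ≤ D) :
    essNorm T ≤ 2 * growthConst * D := by
  set M := ‖T (gBloch vlog 0)‖ with hM
  have hstep : ∀ ρ ∈ Set.Ioo (0 : ℝ) 1, essNorm T ≤ 2 * growthConst * D +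
      M * ((1 - s)⁻¹ / Real.log 2 * (1 - ρ ^ 2)) := by
    rintro ρ ⟨hρ, hρ1⟩
    have hlim : Tendsto (fun N : ℕ => 2 * growthConst * D +
        M * ((1 - s)⁻¹ / Real.log 2 * (1 - ρ ^ 2)) +
        M * (growthConst * logLog ρ * (1 - ρ)⁻¹ * ρ ^ N)) atTop
        (nhds (2 * growthConst * D + M * ((1 - s)⁻¹ / Real.log 2 * (1 - ρ ^ 2)) +
          M * (growthConst * logLog ρ * (1 - ρ)⁻¹ * 0))) :=
      (((tendsto_pow_atTop_nhds_zero_of_lt_one hρ.le hρ1).const_mul _).const_mul _).const_add _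
    simpa using ge_of_tendsto' hlim fun N => essNorm_le_add hT hs hD h hρ hρ1 N
  have hlim : Tendsto (fun ρ : ℝ => 2 * growthConst * D +
      M * ((1 - s)⁻¹ / Real.log 2 * (1 - ρ ^ 2))) (nhdsWithin 1 (Set.Iio 1))
      (nhds (2 * growthConst * D + M * ((1 - s)⁻¹ / Real.log 2 * (1 - 1 ^ 2)))) :=
    (Continuous.tendsto (by fun_prop) 1).mono_left nhdsWithin_le_nhds
  have := ge_of_tendsto hlim (by
    filter_upwards [Ioo_mem_nhdsLT (zero_lt_one' ℝ)] with ρ hρ using hstep ρ hρ)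
  simpa using this

/-! ### Testing on powers -/

/-- If `‖u φⁿ‖ ≤ R ‖g_n‖` for all large `n`, testing at a point `z` with `n` comparable to
`1 / (1 - |φ(z)|)` bounds `v_log |u| / (w_log ∘ φ)` near the unit circle. -/
theorem exists_forall_weight_mul_le {u : 𝔻 → ℂ} {φ : 𝔻 → 𝔻} {R : ℝ} (hR : 0 ≤ R)
    (h : ∀ᶠ n : ℕ in atTop,
      hNorm vlog (u * powFn φ n) ≤ ENNReal.ofReal R * hNorm wlog (g n)) :
    ∃ s : ℝ, s < 1 ∧ ∀ z, s ≤ ‖(φ z : ℂ)‖ →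
      vlog.toFun z * ‖u z‖ * logLog ‖(φ z : ℂ)‖ ≤ 2 * R * (1 + 4 / logLog 0) := by
  obtain ⟨N, hN⟩ := eventually_atTop.1 h
  have hN1 : (0 : ℝ) < N + 1 := by positivity
  refine ⟨1 - 1 / (2 * (N + 1)), ?_, fun z hz => ?_⟩
  · have : 0 < 1 / (2 * ((N : ℝ) + 1)) := by positivity
    linarith
  set x := ‖(φ z : ℂ)‖ with hx
  have hx0 : 0 ≤ x := norm_nonneg _
  have hx1 : x < 1 := (φ z).norm_lt_one
  have hd : 0 < 2 * (1 - x) := by linarith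
  -- The factor `2` makes Bernoulli's inequality give `xⁿ ≥ 1 / 2` instead of a trivial bound.
  set n := ⌊1 / (2 * (1 - x))⌋₊ with hn
  have hn1 : (n : ℝ) * (2 * (1 - x)) ≤ 1 := by
    rw [← le_div_iff₀ hd]
    exact Nat.floor_le (by positivity)
  have hn2 : 1 ≤ 2 * ((n : ℝ) + 1) * (1 - x) := by
    have := (div_lt_iff₀ hd).1 (Nat.lt_floor_add_one (1 / (2 * (1 - x))))
    rw [← hn] at this
    linarith
  have hNn : N ≤ n := by
    refine Nat.le_floor ?_
    rw [le_div_iff₀ hd]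
    have h1 : 1 - x ≤ 1 / (2 * (N + 1)) := by linarith
    rw [le_div_iff₀ (by positivity)] at h1
    nlinarith
  have hpow : 1 / 2 ≤ x ^ n := by
    have := one_add_mul_sub_le_pow (a := x) (by linarith) n
    nlinarith
  have hll : 0 < logLog x := logLog_pos hx0 hx1
  set c := 1 + 4 / logLog 0 with hc
  have hc0 : 0 < c := by
    have := logLog_zero_pos
    positivity
  have hg : hNorm wlog (g n) ≤ ENNReal.ofReal (c / logLog x) := by
    refine (hNorm_le_ofReal_iff (by positivity)).2 fun y => ?_
    have hy : 0 < logLog ‖(y : ℂ)‖ := logLog_pos (norm_nonneg _) y.norm_lt_one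
    have := pow_mul_logLog_le hx0 hx1 (norm_nonneg (y : ℂ)) y.norm_lt_one hn2
    rw [wlog_apply, g, norm_pow, le_div_iff₀ hll, mul_assoc, inv_mul_le_iff₀ hy]
    linarith
  have hu : hNorm vlog (u * powFn φ n) ≤ ENNReal.ofReal (R * (c / logLog x)) := by
    rw [ENNReal.ofReal_mul hR]
    exact (hN n hNn).trans (by gcongr)
  have hz := (hNorm_le_ofReal_iff (by positivity)).1 hu z
  rw [Pi.mul_apply, powFn, norm_mul, norm_pow, ← hx, mul_div_assoc', le_div_iff₀ hll] at hz
  have hV : 0 ≤ vlog.toFun z * ‖u z‖ := mul_nonneg (vlog.pos z).le (norm_nonneg _)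
  have h3 : vlog.toFun z * ‖u z‖ * logLog x * (1 / 2) ≤
      vlog.toFun z * ‖u z‖ * logLog x * x ^ n := by gcongr
  linarith

theorem hNorm_g_pos (v : Weight) (n : ℕ) : 0 < hNorm v (g n) := by
  refine pos_iff_ne_zero.2 fun h => ?_
  have h1 : g n (Complex.UnitDisc.mk (1 / 2) (by norm_num)) = 0 := by
    rw [eq_zero_of_hNorm v h]
    rfl
  exact pow_ne_zero n (by norm_num : (1 / 2 : ℂ) ≠ 0) h1

theorem ofReal_essNorm_le_limsup {u : 𝔻 → ℂ} {φ : 𝔻 → 𝔻} {T : Bloch vlog →L[ℂ] HInf vlog}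
    (hT : IsWeightedComp u φ T) :
    ENNReal.ofReal (essNorm T) ≤ ENNReal.ofReal (4 * growthConst * (1 + 4 / logLog 0)) *
      limsup (fun n : ℕ => hNorm vlog (u * powFn φ n) / hNorm wlog (g n)) atTop := by
  have hC : 0 < 4 * growthConst * (1 + 4 / logLog 0) := by
    have := growthConst_pos
    have := logLog_zero_pos
    positivity
  set C := 4 * growthConst * (1 + 4 / logLog 0)
  set L := limsup (fun n : ℕ => hNorm vlog (u * powFn φ n) / hNorm wlog (g n)) atTop
  rcases eq_or_ne L ∞ with hL | hL
  · rw [hL, ENNReal.mul_top (ENNReal.ofReal_pos.2 hC).ne']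
    exact le_top
  have key : ∀ R : ℝ, L.toReal < R → essNorm T ≤ C * R := by
    intro R hR
    have hR0 : 0 ≤ R := ENNReal.toReal_nonneg.trans hR.le
    have hev : ∀ᶠ n : ℕ in atTop,
        hNorm vlog (u * powFn φ n) ≤ ENNReal.ofReal R * hNorm wlog (g n) := by
      have hlt : L < ENNReal.ofReal R := (ENNReal.lt_ofReal_iff_toReal_lt hL).2 hR
      filter_upwards [eventually_lt_of_limsup_lt hlt] with n hn
      exact (ENNReal.div_le_iff (hNorm_g_pos wlog n).ne' (hNorm_g_lt_top wlog n).ne).1 hn.le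
    obtain ⟨s, hs1, hs⟩ := exists_forall_weight_mul_le hR0 hev
    have hD : 0 ≤ 2 * R * (1 + 4 / logLog 0) := by
      have := logLog_zero_pos
      positivity
    refine (essNorm_le_of_forall hT hs1 hD hs).trans_eq ?_
    simp only [C]
    ring
  have hfin : essNorm T ≤ C * L.toReal := by
    refine ge_of_tendsto (x := nhdsWithin L.toReal (Set.Ioi L.toReal)) (f := fun R => C * R)
      ((Continuous.tendsto (by fun_prop) _).mono_left nhdsWithin_le_nhds) ?_
    filter_upwards [self_mem_nhdsWithin] with R hR using key R hR
  calc ENNReal.ofReal (essNorm T) ≤ ENNReal.ofReal (C * L.toReal) := ENNReal.ofReal_le_ofReal hfin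
    _ = ENNReal.ofReal C * L := by rw [ENNReal.ofReal_mul hC.le, ENNReal.ofReal_toReal hL]

/-! ### The integral operator -/

theorem IsHolo.mul {f h : 𝔻 → ℂ} (hf : IsHolo f) (hh : IsHolo h) : IsHolo (f * h) := by
  refine isHolo_of_eq (F := fun z => ext f z * ext h z) (fun z => ?_)
    (DifferentiableOn.mul hf hh)
  simp [ext_coe]

theorem isHolo_derivD {f : 𝔻 → ℂ} (hf : IsHolo f) : IsHolo (derivD f) :=
  isHolo_of_eq (F := deriv (ext f)) (fun _ => rfl) (DifferentiableOn.deriv hf Metric.isOpen_ball)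

/-- A holomorphic function on the disc has a primitive there, and integrals along radii are
differences of its values. -/
theorem derivD_J {u f : 𝔻 → ℂ} (hu : IsHolo u) (hf : IsHolo f) :
    derivD (J u f) = derivD u * f := by
  have hp : IsHolo (f * derivD u) := hf.mul (isHolo_derivD hu)
  obtain ⟨G, hG⟩ := DifferentiableOn.isExactOn_ball hp
  have hJ : ∀ z : 𝔻, J u f z = G z - G 0 := by
    intro z
    have hball : ∀ t ∈ Set.uIcc (0 : ℝ) 1, ‖(t : ℂ) * (z : ℂ)‖ < 1 := by
      intro t ht
      rw [Set.uIcc_of_le zero_le_one] at ht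
      rw [norm_mul, Complex.norm_real, Real.norm_of_nonneg ht.1]
      nlinarith [ht.2, norm_nonneg (z : ℂ), z.norm_lt_one]
    have hmul : ∀ w : ℂ, ‖w‖ < 1 →
        ext f w * ext (derivD u) w = ext (f * derivD u) w := by
      intro w hw
      simp [ext, hw]
    have hd : ∀ t ∈ Set.uIcc (0 : ℝ) 1, HasDerivAt (fun s : ℝ => G (s * z))
        (ext f (t * (z : ℂ)) * ext (derivD u) (t * (z : ℂ)) * (z : ℂ)) t := by
      intro t ht
      rw [hmul _ (hball t ht)]
      have h1 := hG (t * z) (mem_ball_zero_iff.2 (hball t ht))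
      have h2 : HasDerivAt (fun s : ℂ => s * (z : ℂ)) z (t : ℂ) := by
        simpa using (hasDerivAt_id (t : ℂ)).mul_const (z : ℂ)
      exact (HasDerivAt.comp (t : ℂ) h1 h2).comp_ofReal
    have hcont : ContinuousOn (fun t : ℝ => ext f (t * (z : ℂ)) *
        ext (derivD u) (t * (z : ℂ)) * (z : ℂ)) (Set.uIcc 0 1) := by
      have hline : ContinuousOn (fun t : ℝ => (t : ℂ) * (z : ℂ)) (Set.uIcc 0 1) := by fun_prop
      have hmaps : Set.MapsTo (fun t : ℝ => (t : ℂ) * (z : ℂ)) (Set.uIcc 0 1)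
          (Metric.ball 0 1) := fun t ht => mem_ball_zero_iff.2 (hball t ht)
      exact ((hf.continuousOn.comp hline hmaps).mul
        ((isHolo_derivD hu).continuousOn.comp hline hmaps)).mul continuousOn_const
    have := intervalIntegral.integral_eq_sub_of_hasDerivAt hd hcont.intervalIntegrable
    simpa [J] using this
  funext z
  have hz : (z : ℂ) ∈ Metric.ball (0 : ℂ) 1 := by simpa using z.norm_lt_one
  rw [derivD_of_eq (F := fun w => G w - G 0) hJ z, ((hG z hz).sub_const (G 0)).deriv, ext_coe,
    mul_comm]

theorem isHolo_powFn {φ : 𝔻 → 𝔻} (hφ : IsHolo (fun z => (φ z : ℂ))) (n : ℕ) :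
    IsHolo (powFn φ n) := by
  refine isHolo_of_eq (F := fun z => ext (fun z => (φ z : ℂ)) z ^ n) (fun z => ?_)
    (DifferentiableOn.pow hφ n)
  rw [ext_coe]
  rfl

theorem bNorm_J {u f : 𝔻 → ℂ} (v : Weight) (hu : IsHolo u) (hf : IsHolo f) :
    bNorm v (J u f) = hNorm v (derivD u * f) := by
  have h0 : J u f 0 = 0 := by simp [J]
  simp [bNorm, derivD_J hu hf, h0]

theorem succ_mul_bNorm_J_div {u : 𝔻 → ℂ} {φ : 𝔻 → 𝔻} (hu : IsHolo u)
    (hφ : IsHolo (fun z => (φ z : ℂ))) (v w : Weight) (n : ℕ) :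
    (n + 1) * bNorm v (J u (powFn φ n)) / bNorm w (g (n + 1)) =
      hNorm v (derivD u * powFn φ n) / hNorm w (g n) := by
  rw [bNorm_J v hu (isHolo_powFn hφ n), bNorm_g_succ]
  exact ENNReal.mul_div_mul_left _ _ (by simp) (by finiteness)

end LogBloch

end

theorem mainTheorem4 :
    ∃ C : ℝ, 0 < C ∧
      ∀ (u : 𝔻 → ℂ) (φ : 𝔻 → 𝔻), IsHolo u → IsHolo (fun z => (φ z : ℂ)) →
        (∀ T : Bloch vlog →L[ℂ] HInf vlog, IsWeightedComp u φ T →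
          ENNReal.ofReal (essNorm T) ≤
            ENNReal.ofReal C *
              limsup (fun n : ℕ => hNorm vlog (u * powFn φ n) / hNorm wlog (g n)) atTop) ∧
        (∀ T : Bloch vlog →L[ℂ] HInf vlog, IsWeightedComp (derivD u) φ T →
          ENNReal.ofReal (essNorm T) ≤
            ENNReal.ofReal C *
              limsup (fun n : ℕ =>
                (n + 1) * bNorm vlog (J u (powFn φ n)) / bNorm wlog (g (n + 1))) atTop) := by
  refine ⟨4 * growthConst * (1 + 4 / logLog 0), ?_, fun u φ hu hφ => ⟨fun T hT =>
    ofReal_essNorm_le_limsup hT, fun T hT => ?_⟩⟩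
  · have := growthConst_pos
    have := logLog_zero_pos
    positivity
  · simp only [succ_mul_bNorm_J_div hu hφ]
    exact ofReal_essNorm_le_limsup hT
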